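/- Let $E$ be a reflexive (real or complex) Banach space with the approximation property, that is, for every compact set $K\subset E$ and every $\varepsilon>0$ there is a bounded finite-rank operator $T$ on $E$ with $\|Tx-x\|<\varepsilon$ for all $x\in K$. Let $\mathcal{B}(E)$ be the algebra of bounded linear operators on $E$, with the weak*-topology given by its predual, the projective tensor product $E\widehat{\otimes}E'$, under the duality determined by $\langle T, x\otimes\lambda\rangle=\lambda(Tx)$. Then the weak*-closed left ideals of $\mathcal{B}(E)$ are exactly the sets $$\{T\in\mathcal{B}(E) : \ker T\supset F\},$$ where $F$ runs through the closed linear subspaces of $E$, and the weak*-closed right ideals of $\mathcal{B}(E)$ are exactly the sets $$\{T\in\mathcal{B}(E) : \operatorname{im} T\subset F\},$$ where $F$ runs through the closed linear subspaces of $E$. -/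

import Mathlib

open scoped TensorProduct Topology

noncomputable section

/-- A Banach space is reflexive if the canonical map into its bidual is onto. -/
def IsReflexiveSpace (𝕜 E : Type*) [RCLike 𝕜] [NormedAddCommGroup E] [NormedSpace 𝕜 E] : Prop :=
  Function.Surjective (NormedSpace.inclusionInDoubleDual 𝕜 E)

/-- The approximation property: on every compact subset of `E` the identity is a uniform limit of
bounded operators of finite rank. -/
def HasApproximationProperty (𝕜 E : Type*) [RCLike 𝕜] [NormedAddCommGroup E]
    [NormedSpace 𝕜 E] : Prop :=
  ∀ K : Set E, IsCompact K → ∀ ε : ℝ, 0 < ε →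
    ∃ T : E →L[𝕜] E, FiniteDimensional 𝕜 (LinearMap.range (T : E →ₗ[𝕜] E)) ∧
      ∀ x ∈ K, ‖T x - x‖ < ε

section ProjectiveTensorProduct

variable (𝕜 E F : Type*) [RCLike 𝕜] [NormedAddCommGroup E] [NormedSpace 𝕜 E]
  [NormedAddCommGroup F] [NormedSpace 𝕜 F]

/-- The algebraic tensor product `E ⊗ F`; a type synonym that carries the projective norm. -/
def AlgProjTensor : Type _ := E ⊗[𝕜] F

instance : AddCommGroup (AlgProjTensor 𝕜 E F) := inferInstanceAs (AddCommGroup (E ⊗[𝕜] F))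

instance : Module 𝕜 (AlgProjTensor 𝕜 E F) := inferInstanceAs (Module 𝕜 (E ⊗[𝕜] F))

variable {E F}

/-- The elementary tensor `x ⊗ y`. -/
def projTmul (x : E) (y : F) : AlgProjTensor 𝕜 E F := (x ⊗ₜ[𝕜] y : E ⊗[𝕜] F)

/-- The element `∑ xᵢ ⊗ yᵢ` given by a finite list of pairs `(xᵢ, yᵢ)`. -/
def tensorOfList (l : List (E × F)) : AlgProjTensor 𝕜 E F :=
  (l.map fun p => projTmul 𝕜 p.1 p.2).sum

/-- The number `∑ ‖xᵢ‖ ‖yᵢ‖` given by a finite list of pairs `(xᵢ, yᵢ)`. -/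
def costOfList (l : List (E × F)) : ℝ := (l.map fun p => ‖p.1‖ * ‖p.2‖).sum

variable {𝕜}

/-- The projective norm: the infimum of `∑ ‖xᵢ‖ ‖yᵢ‖` over all finite representations
`u = ∑ xᵢ ⊗ yᵢ`. -/
def projNorm (u : AlgProjTensor 𝕜 E F) : ℝ :=
  sInf (costOfList '' {l : List (E × F) | tensorOfList 𝕜 l = u})

theorem costOfList_nonneg (l : List (E × F)) : 0 ≤ costOfList l := by
  refine List.sum_nonneg fun a ha => ?_
  obtain ⟨p, -, rfl⟩ := List.mem_map.1 ha
  positivity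

theorem exists_tensorOfList (u : AlgProjTensor 𝕜 E F) :
    ∃ l : List (E × F), tensorOfList 𝕜 l = u := by
  refine TensorProduct.induction_on
    (motive := fun u : E ⊗[𝕜] F => ∃ l : List (E × F), tensorOfList 𝕜 l = u) u ?_ ?_ ?_
  · exact ⟨[], rfl⟩
  · exact fun x y => ⟨[(x, y)], add_zero (projTmul 𝕜 x y)⟩
  · rintro _ _ ⟨l, rfl⟩ ⟨m, rfl⟩
    refine ⟨l ++ m, ?_⟩
    rw [tensorOfList, List.map_append, List.sum_append]
    rfl

theorem projNorm_le (l : List (E × F)) : projNorm (tensorOfList 𝕜 l) ≤ costOfList l :=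
  csInf_le ⟨0, by rintro _ ⟨m, -, rfl⟩; exact costOfList_nonneg m⟩ ⟨l, rfl, rfl⟩

theorem le_projNorm {u : AlgProjTensor 𝕜 E F} {c : ℝ}
    (h : ∀ l : List (E × F), tensorOfList 𝕜 l = u → c ≤ costOfList l) : c ≤ projNorm u := by
  obtain ⟨l, hl⟩ := exists_tensorOfList u
  refine le_csInf ⟨_, l, hl, rfl⟩ ?_
  rintro _ ⟨m, hm, rfl⟩
  exact h m hm

theorem projNorm_add_le (u v : AlgProjTensor 𝕜 E F) :
    projNorm (u + v) ≤ projNorm u + projNorm v := by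
  rw [← sub_le_iff_le_add]
  refine le_projNorm fun l hl => ?_
  rw [sub_le_comm]
  refine le_projNorm fun m hm => ?_
  rw [sub_le_iff_le_add']
  have h := projNorm_le (𝕜 := 𝕜) (l ++ m)
  have h1 : tensorOfList 𝕜 (l ++ m) = u + v := by
    rw [← hl, ← hm]; simp only [tensorOfList, List.map_append, List.sum_append]
  have h2 : costOfList (l ++ m) = costOfList l + costOfList m := by
    simp only [costOfList, List.map_append, List.sum_append]
  rwa [h1, h2] at h

theorem projNorm_smul_le (a : 𝕜) (u : AlgProjTensor 𝕜 E F) :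
    projNorm (a • u) ≤ ‖a‖ * projNorm u := by
  have key : ∀ l : List (E × F), tensorOfList 𝕜 l = u →
      projNorm (a • u) ≤ ‖a‖ * costOfList l := by
    intro l hl
    have h := projNorm_le (𝕜 := 𝕜) (l.map fun p => (a • p.1, p.2))
    have h1 : tensorOfList 𝕜 (l.map fun p => (a • p.1, p.2)) = a • u := by
      rw [← hl, tensorOfList, tensorOfList, List.smul_sum, List.map_map, List.map_map]
      rfl
    have h2 : costOfList (l.map fun p => (a • p.1, p.2)) = ‖a‖ * costOfList l := by
      simp [costOfList, Function.comp_def, norm_smul, mul_assoc, List.sum_map_mul_left]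
    rwa [h1, h2] at h
  rcases eq_or_ne a 0 with rfl | ha
  · obtain ⟨l, hl⟩ := exists_tensorOfList u
    simpa using key l hl
  · have hpos : 0 < ‖a‖ := norm_pos_iff.2 ha
    rw [← div_le_iff₀' hpos]
    exact le_projNorm fun l hl => (div_le_iff₀' hpos).2 (key l hl)

theorem projNorm_zero : projNorm (0 : AlgProjTensor 𝕜 E F) = 0 :=
  le_antisymm (projNorm_le (𝕜 := 𝕜) ([] : List (E × F)))
    (le_projNorm fun l _ => costOfList_nonneg l)

variable (𝕜 E F) in
/-- `projNorm` as a seminorm. -/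
def projSeminorm : Seminorm 𝕜 (AlgProjTensor 𝕜 E F) :=
  .ofSMulLE projNorm projNorm_zero projNorm_add_le projNorm_smul_le

instance : SeminormedAddCommGroup (AlgProjTensor 𝕜 E F) :=
  AddGroupSeminorm.toSeminormedAddCommGroup (projSeminorm 𝕜 E F).toAddGroupSeminorm

instance : NormedSpace 𝕜 (AlgProjTensor 𝕜 E F) := ⟨projNorm_smul_le⟩

variable (𝕜 E F) in
/-- The projective tensor product of `E` and `F`: the completion of the algebraic tensor product
in the projective norm. -/
abbrev ProjTensor : Type _ := UniformSpace.Completion (AlgProjTensor 𝕜 E F)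

end ProjectiveTensorProduct

section WeakStar

variable {𝕜 E : Type*} [RCLike 𝕜] [NormedAddCommGroup E] [NormedSpace 𝕜 E]

/-- The linear functional `∑ xᵢ ⊗ lᵢ ↦ ∑ lᵢ (T xᵢ)` on the algebraic tensor product. -/
def algTracePairing (T : E →L[𝕜] E) : AlgProjTensor 𝕜 E (StrongDual 𝕜 E) →ₗ[𝕜] 𝕜 :=
  TensorProduct.lift
    (LinearMap.mk₂ 𝕜 (fun (x : E) (l : StrongDual 𝕜 E) => l (T x))
      (by simp) (by simp) (by simp) (by simp))

theorem algTracePairing_tensorOfList (T : E →L[𝕜] E) (l : List (E × StrongDual 𝕜 E)) :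
    algTracePairing T (tensorOfList 𝕜 l) = (l.map fun p => p.2 (T p.1)).sum := by
  induction l with
  | nil => exact map_zero (algTracePairing T)
  | cons p l ih =>
    have h : algTracePairing T (projTmul 𝕜 p.1 p.2) = p.2 (T p.1) := TensorProduct.lift.tmul _ _
    rw [tensorOfList, List.map_cons, List.sum_cons, map_add, h, List.map_cons, List.sum_cons]
    exact congrArg _ ih

theorem norm_algTracePairing_le (T : E →L[𝕜] E) (u : AlgProjTensor 𝕜 E (StrongDual 𝕜 E)) :
    ‖algTracePairing T u‖ ≤ ‖T‖ * ‖u‖ := by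
  have key : ∀ l : List (E × StrongDual 𝕜 E),
      ‖(l.map fun p => p.2 (T p.1)).sum‖ ≤ ‖T‖ * costOfList l := by
    intro l
    induction l with
    | nil => simp [costOfList]
    | cons p l ih =>
      have h1 : ‖p.2 (T p.1)‖ ≤ ‖T‖ * (‖p.1‖ * ‖p.2‖) := by
        calc ‖p.2 (T p.1)‖ ≤ ‖p.2‖ * ‖T p.1‖ := p.2.le_opNorm _
          _ ≤ ‖p.2‖ * (‖T‖ * ‖p.1‖) := by gcongr; exact T.le_opNorm _
          _ = ‖T‖ * (‖p.1‖ * ‖p.2‖) := by ring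
      simp only [costOfList, List.map_cons, List.sum_cons, mul_add] at ih ⊢
      exact (norm_add_le _ _).trans (add_le_add h1 ih)
  change _ ≤ ‖T‖ * projNorm u
  rcases (norm_nonneg T).eq_or_lt with h0 | hpos
  · obtain ⟨l, rfl⟩ := exists_tensorOfList u
    have := key l
    rw [← h0, zero_mul] at this ⊢
    rwa [algTracePairing_tensorOfList]
  · rw [← div_le_iff₀' hpos]
    refine le_projNorm fun l hl => (div_le_iff₀' hpos).2 ?_
    rw [← hl, algTracePairing_tensorOfList]
    exact key l

/-- The functional on the projective tensor product `E ⊗̂ E'` that an operator `T` on `E` defines: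
the continuous extension of `∑ xᵢ ⊗ lᵢ ↦ ∑ lᵢ (T xᵢ)`. For reflexive `E` the map
`T ↦ tracePairing T` identifies the bounded operators on `E` with the dual of `E ⊗̂ E'`. -/
def tracePairing (T : E →L[𝕜] E) : StrongDual 𝕜 (ProjTensor 𝕜 E (StrongDual 𝕜 E)) :=
  ((algTracePairing T).mkContinuous ‖T‖ (norm_algTracePairing_le T)).extend
    UniformSpace.Completion.toComplL

/-- On the algebraic tensor product `tracePairing T` is the functional it should be. -/
theorem tracePairing_coe (T : E →L[𝕜] E) (u : AlgProjTensor 𝕜 E (StrongDual 𝕜 E)) :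
    tracePairing T (u : ProjTensor 𝕜 E (StrongDual 𝕜 E)) = algTracePairing T u :=
  ContinuousLinearMap.extend_eq _ UniformSpace.Completion.denseRange_coe
    (UniformSpace.Completion.isUniformInducing_coe _) u

variable (𝕜 E) in
/-- The weak*-topology on the bounded operators on `E`, with respect to the predual `E ⊗̂ E'`. -/
@[reducible]
def weakStarTopology : TopologicalSpace (E →L[𝕜] E) :=
  TopologicalSpace.induced (fun T => StrongDual.toWeakDual (tracePairing T)) inferInstance

/-- The left ideal of all bounded operators on `E` whose kernel contains `D`. -/
def kerIdeal (D : Submodule 𝕜 E) : Ideal (E →L[𝕜] E) where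
  carrier := {T | D ≤ LinearMap.ker (T : E →ₗ[𝕜] E)}
  add_mem' {S T} hS hT x hx := by
    have h1 : S x = 0 := hS hx
    have h2 : T x = 0 := hT hx
    simp [h1, h2]
  zero_mem' x _ := by simp
  smul_mem' R T hT x hx := by
    have h : T x = 0 := hT hx
    simp [h]

/-- The right ideal of all bounded operators on `E` whose image is contained in `D`. Right ideals
of a ring are its submodules as a module over the opposite ring. -/
def imIdeal (D : Submodule 𝕜 E) : Submodule (E →L[𝕜] E)ᵐᵒᵖ (E →L[𝕜] E) where
  carrier := {T | LinearMap.range (T : E →ₗ[𝕜] E) ≤ D}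
  add_mem' {S T} hS hT := by
    rintro _ ⟨x, rfl⟩
    exact D.add_mem (hS ⟨x, rfl⟩) (hT ⟨x, rfl⟩)
  zero_mem' := by
    rintro _ ⟨x, rfl⟩
    exact D.zero_mem
  smul_mem' R T hT := by
    rintro _ ⟨x, rfl⟩
    exact hT ⟨R.unop x, rfl⟩

end WeakStar

end

/-!
The heart of the matter is that a weak*-closed set of operators is closed under approximation
uniformly on compact sets (`mem_of_isClosed_weakStar`). This holds because an element of `E ⊗̂ E'`
can be written as `∑ xₙ ⊗ lₙ` with `xₙ → 0` and `∑ ‖lₙ‖ < ∞`, so that the functional it defines is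
bounded by a multiple of the supremum of `‖T x‖` over a compact set of vectors `x`
(`exists_isCompact_norm_tracePairing_le`).

Given this, the approximation property reduces an ideal to its operators of rank one, here
`l.smulRight y : x ↦ l x • y`. For a weak*-closed right ideal `J`, the vectors `y` such that `J`
contains every `l.smulRight y` form a closed subspace `F`, which contains the image of each member
of `J`. If the image of `S` lies in `F`, and `R` has finite rank and is close to the identity on a
compact set, then `S R` is a sum of operators of rank one in `J` and is close to `S` there; so `S`
lies in `J`. For a weak*-closed left ideal `J` the functionals `l` such that `J` contains every
`l.smulRight y` form a norm-closed subspace `M` of `E'`. Let `F` be its preannihilator; each member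
of `J` vanishes on `F`. By reflexivity `M` is the whole annihilator of `F`
(`mem_of_forall_mem_preannihilator`), so if `S` vanishes on `F` then each `R S` lies in `J`, and
with it `S`.
-/

open Filter

/-! ### The trace pairing and compact convergence -/

section Pairing

variable {𝕜 E : Type*} [RCLike 𝕜] [NormedAddCommGroup E] [NormedSpace 𝕜 E]

theorem algTracePairing_projTmul (T : E →L[𝕜] E) (x : E) (l : StrongDual 𝕜 E) :
    algTracePairing T (projTmul 𝕜 x l) = l (T x) :=
  TensorProduct.lift.tmul _ _

theorem tracePairing_projTmul (T : E →L[𝕜] E) (x : E) (l : StrongDual 𝕜 E) :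
    tracePairing T (projTmul 𝕜 x l : ProjTensor 𝕜 E (StrongDual 𝕜 E)) = l (T x) := by
  rw [tracePairing_coe, algTracePairing_projTmul]

theorem algTracePairing_sub (S T : E →L[𝕜] E) (u : AlgProjTensor 𝕜 E (StrongDual 𝕜 E)) :
    algTracePairing (S - T) u = algTracePairing S u - algTracePairing T u := by
  obtain ⟨l, rfl⟩ := exists_tensorOfList u
  simp only [algTracePairing_tensorOfList]
  induction l with
  | nil => simp
  | cons p l ih =>
    rw [List.map_cons, List.sum_cons, ih]
    simp only [List.map_cons, List.sum_cons, sub_apply, map_sub]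
    ring

theorem tracePairing_sub (S T : E →L[𝕜] E) (u : ProjTensor 𝕜 E (StrongDual 𝕜 E)) :
    tracePairing (S - T) u = tracePairing S u - tracePairing T u := by
  induction u using UniformSpace.Completion.induction_on with
  | hp => exact isClosed_eq (by fun_prop) (by fun_prop)
  | ih u => simp only [tracePairing_coe, algTracePairing_sub]

theorem continuous_tracePairing_apply (u : ProjTensor 𝕜 E (StrongDual 𝕜 E)) :
    Continuous[weakStarTopology 𝕜 E, _] fun T => tracePairing T u := by
  let _ : TopologicalSpace (E →L[𝕜] E) := weakStarTopology 𝕜 E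
  exact (WeakDual.eval_continuous u).comp continuous_induced_dom

theorem continuous_weakStar_apply (x : E) (l : StrongDual 𝕜 E) :
    Continuous[weakStarTopology 𝕜 E, _] fun T : E →L[𝕜] E => l (T x) := by
  simpa only [tracePairing_projTmul] using
    continuous_tracePairing_apply (projTmul 𝕜 x l : ProjTensor 𝕜 E (StrongDual 𝕜 E))

theorem exists_costOfList_lt {F : Type*} [NormedAddCommGroup F] [NormedSpace 𝕜 F]
    {u : AlgProjTensor 𝕜 E F} {c : ℝ} (h : ‖u‖ < c) :
    ∃ l : List (E × F), tensorOfList 𝕜 l = u ∧ costOfList l < c := by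
  obtain ⟨l, hl⟩ := exists_tensorOfList u
  obtain ⟨_, ⟨m, hm, rfl⟩, hc⟩ := exists_lt_of_csInf_lt
    (s := costOfList '' {l : List (E × F) | tensorOfList 𝕜 l = u}) ⟨_, l, hl, rfl⟩ h
  exact ⟨m, hm, hc⟩

/-- The vectors of a finite tensor may be scaled to a prescribed length `r`; the pairing with `T`
is then controlled by the size of `T` on the scaled vectors. A zero vector is scaled to zero, and
contributes nothing. -/
theorem norm_algTracePairing_tensorOfList_le (T : E →L[𝕜] E) {r δ : ℝ} (hr : 0 < r)
    (l : List (E × StrongDual 𝕜 E))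
    (h : ∀ p ∈ l, ‖T (((r / ‖p.1‖ : ℝ) : 𝕜) • p.1)‖ ≤ δ) :
    ‖algTracePairing T (tensorOfList 𝕜 l)‖ ≤ r⁻¹ * costOfList l * δ := by
  rw [algTracePairing_tensorOfList]
  induction l with
  | nil => simp [costOfList]
  | cons p l ih =>
    have hp : ‖T p.1‖ ≤ r⁻¹ * ‖p.1‖ * δ := by
      rcases eq_or_ne p.1 0 with h0 | h0
      · simp [h0]
      have hpos : 0 < ‖p.1‖ := norm_pos_iff.2 h0
      have h1 := h p (by simp)
      rw [map_smul, norm_smul, RCLike.norm_ofReal, abs_of_pos (by positivity)] at h1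
      calc ‖T p.1‖ = r⁻¹ * ‖p.1‖ * (r / ‖p.1‖ * ‖T p.1‖) := by field_simp
        _ ≤ _ := by gcongr
    have h2 : ‖p.2 (T p.1)‖ ≤ r⁻¹ * (‖p.1‖ * ‖p.2‖) * δ := by
      calc ‖p.2 (T p.1)‖ ≤ ‖p.2‖ * ‖T p.1‖ := p.2.le_opNorm _
        _ ≤ ‖p.2‖ * (r⁻¹ * ‖p.1‖ * δ) := by gcongr
        _ = _ := by ring
    have h3 := ih fun q hq => h q (by simp [hq])
    simp only [costOfList, List.map_cons, List.sum_cons, mul_add, add_mul] at h3 ⊢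
    exact (norm_add_le _ _).trans (add_le_add h2 h3)

/-- An element of `E ⊗̂ E'` is a sum `∑ xₙ ⊗ lₙ` with `xₙ → 0` and `∑ ‖lₙ‖ < ∞`. Hence its pairing
with an operator `T` is controlled by the size of `T` on the compact set `{xₙ} ∪ {0}`. -/
theorem exists_isCompact_norm_tracePairing_le (u : ProjTensor 𝕜 E (StrongDual 𝕜 E)) :
    ∃ K : Set E, IsCompact K ∧ ∃ C : ℝ, ∀ (T : E →L[𝕜] E) (δ : ℝ), (∀ x ∈ K, ‖T x‖ ≤ δ) →
      ‖tracePairing T u‖ ≤ C * δ := by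
  let s : AddSubgroup (ProjTensor 𝕜 E (StrongDual 𝕜 E)) :=
    (UniformSpace.Completion.toCompl (α := AlgProjTensor 𝕜 E (StrongDual 𝕜 E))).range
  have hu : u ∈ closure (s : Set (ProjTensor 𝕜 E (StrongDual 𝕜 E))) :=
    UniformSpace.Completion.denseRange_coe u
  obtain ⟨v, hv, hvs, -, hvn⟩ :=
    controlled_sum_of_mem_closure hu (b := fun n => (1 / 4 : ℝ) ^ n) (fun n => by positivity)
  choose w hw using hvs
  -- The first term is not small; the constant `c` takes care of it.
  let c : ℝ := ‖w 0‖ + 1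
  have hc : 1 ≤ c := by simp [c]
  have hlist : ∀ n, ∃ l : List (E × StrongDual 𝕜 E),
      tensorOfList 𝕜 l = w n ∧ costOfList l < c * (1 / 4 : ℝ) ^ n := by
    intro n
    apply exists_costOfList_lt
    rcases Nat.eq_zero_or_pos n with rfl | hn
    · simp [c]
    · have h := hvn n hn
      rw [← hw n] at h
      have h' : ‖w n‖ < (1 / 4 : ℝ) ^ n := by
        simpa only [UniformSpace.Completion.toCompl_apply, UniformSpace.Completion.norm_coe] using h
      exact h'.trans_le (le_mul_of_one_le_left (by positivity) hc)
  choose l hl hcost using hlist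
  -- The vectors in the `n`-th term are scaled to length `2⁻ⁿ`, at a total cost of order `2⁻ⁿ`.
  let f : (Σ n, Fin (l n).length) → E := fun i =>
    (((1 / 2 : ℝ) ^ i.1 / ‖((l i.1).get i.2).1‖ : ℝ) : 𝕜) • ((l i.1).get i.2).1
  have hfn : ∀ i, ‖f i‖ ≤ (1 / 2 : ℝ) ^ i.1 := by
    intro i
    simp only [f]
    rw [norm_smul, RCLike.norm_ofReal, abs_of_nonneg (by positivity)]
    rcases eq_or_ne ‖((l i.1).get i.2).1‖ 0 with h0 | h0
    · rw [h0, mul_zero]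
      positivity
    · rw [div_mul_cancel₀ _ h0]
  have hf : Tendsto f cofinite (𝓝 0) := by
    rw [Metric.tendsto_nhds]
    intro ε hε
    obtain ⟨N, hN⟩ := exists_pow_lt_of_lt_one hε (by norm_num : (1 / 2 : ℝ) < 1)
    have hfin : ((Finset.range N).sigma fun n => (Finset.univ : Finset (Fin (l n).length)) :
        Set (Σ n, Fin (l n).length)).Finite := Finset.finite_toSet _
    refine hfin.subset fun i hi => ?_
    simp only [Finset.coe_sigma, Set.mem_sigma_iff, Finset.coe_range, Set.mem_Iio,
      Finset.coe_univ, Set.mem_univ, and_true]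
    by_contra! hle
    refine hi ?_
    change dist (f i) 0 < ε
    rw [dist_zero_right]
    exact (hfn i).trans_lt
      ((pow_le_pow_of_le_one (by norm_num) (by norm_num) hle).trans_lt hN)
  refine ⟨insert 0 (Set.range f), hf.isCompact_insert_range_of_cofinite, c * 2,
    fun T δ hT => ?_⟩
  have hδ : 0 ≤ δ := by simpa using hT 0 (by simp)
  have hterm : ∀ n, ‖tracePairing T (v n)‖ ≤ (1 / 2 : ℝ) ^ n * (c * δ) := by
    intro n
    have hvw : tracePairing T (v n) = algTracePairing T (tensorOfList 𝕜 (l n)) := by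
      rw [← hw n, UniformSpace.Completion.toCompl_apply, tracePairing_coe, hl n]
    rw [hvw]
    refine (norm_algTracePairing_tensorOfList_le T (r := (1 / 2 : ℝ) ^ n) (δ := δ) (by positivity)
      (l n) ?_).trans ?_
    · intro p hp
      obtain ⟨i, rfl⟩ := List.mem_iff_get.1 hp
      exact hT _ (Set.mem_insert_of_mem _ ⟨⟨n, i⟩, rfl⟩)
    · have h4 : (1 / 4 : ℝ) ^ n = (1 / 2) ^ n * (1 / 2) ^ n := by rw [← mul_pow]; norm_num
      calc ((1 / 2 : ℝ) ^ n)⁻¹ * costOfList (l n) * δ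
          ≤ ((1 / 2 : ℝ) ^ n)⁻¹ * (c * (1 / 4 : ℝ) ^ n) * δ := by gcongr; exact (hcost n).le
        _ = _ := by rw [h4]; field_simp
  have hlim : Tendsto (fun n => ‖∑ i ∈ Finset.range (n + 1), tracePairing T (v i)‖) atTop
      (𝓝 ‖tracePairing T u‖) := by
    simpa only [map_sum, Function.comp_def] using
      (((tracePairing T).continuous.tendsto u).comp hv).norm
  refine le_of_tendsto' hlim fun n => ?_
  calc ‖∑ i ∈ Finset.range (n + 1), tracePairing T (v i)‖
      ≤ ∑ i ∈ Finset.range (n + 1), (1 / 2 : ℝ) ^ i * (c * δ) :=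
        norm_sum_le_of_le _ fun i _ => hterm i
    _ = (∑ i ∈ Finset.range (n + 1), (1 / 2 : ℝ) ^ i) * (c * δ) := by rw [Finset.sum_mul]
    _ ≤ 2 * (c * δ) := by gcongr; exact sum_geometric_two_le _
    _ = c * 2 * δ := by ring

/-- A weak*-closed set contains every operator that its elements approximate uniformly on compact
sets: on `B(E)` the weak*-topology is coarser than that of compact convergence. -/
theorem mem_of_isClosed_weakStar {J : Set (E →L[𝕜] E)} (hJ : IsClosed[weakStarTopology 𝕜 E] J)
    {S : E →L[𝕜] E}
    (h : ∀ K : Set E, IsCompact K → ∀ ε : ℝ, 0 < ε → ∃ T ∈ J, ∀ x ∈ K, ‖T x - S x‖ < ε) :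
    S ∈ J := by
  -- Approximants indexed by a compact set and a tolerance form a net that converges to `S`.
  have h' : ∀ i : TopologicalSpace.Compacts E × ℕ,
      ∃ T ∈ J, ∀ x ∈ i.1, ‖T x - S x‖ < 1 / ((i.2 : ℝ) + 1) :=
    fun i => h i.1 i.1.isCompact _ (by positivity)
  choose T hTJ hT using h'
  let _ : TopologicalSpace (E →L[𝕜] E) := weakStarTopology 𝕜 E
  refine IsClosed.mem_of_tendsto (f := T) (b := atTop) hJ ?_ (Eventually.of_forall hTJ)
  rw [nhds_induced, tendsto_comap_iff, tendsto_iff_forall_eval_tendsto_topDualPairing]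
  intro u
  change Tendsto (fun i => tracePairing (T i) u) atTop (𝓝 (tracePairing S u))
  obtain ⟨K, hK, C, hC⟩ := exists_isCompact_norm_tracePairing_le u
  rw [tendsto_iff_norm_sub_tendsto_zero]
  have hlim : Tendsto (fun i : TopologicalSpace.Compacts E × ℕ => C * (1 / ((i.2 : ℝ) + 1)))
      atTop (𝓝 0) := by
    rw [← prod_atTop_atTop_eq]
    simpa using (tendsto_one_div_add_atTop_nhds_zero_nat (𝕜 := ℝ)).comp tendsto_snd |>.const_mul C
  refine squeeze_zero' (Eventually.of_forall fun _ => norm_nonneg _) ?_ hlim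
  filter_upwards [eventually_ge_atTop ((⟨K, hK⟩ : TopologicalSpace.Compacts E), 0)] with i hi
  rw [← tracePairing_sub]
  exact hC _ _ fun x hx => (hT i x (hi.1 hx)).le

theorem isClosed_of_isClosed_weakStar {J : Set (E →L[𝕜] E)}
    (hJ : IsClosed[weakStarTopology 𝕜 E] J) : IsClosed J := by
  refine isClosed_of_closure_subset fun S hS => mem_of_isClosed_weakStar hJ fun K hK ε hε => ?_
  obtain ⟨r, hr⟩ := hK.isBounded.exists_norm_le
  obtain ⟨T, hTJ, hT⟩ := Metric.mem_closure_iff.1 hS (ε / (|r| + 1)) (by positivity)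
  refine ⟨T, hTJ, fun x hx => ?_⟩
  have hx' : ‖x‖ ≤ |r| := (hr x hx).trans (le_abs_self r)
  rw [dist_comm, dist_eq_norm] at hT
  calc ‖T x - S x‖ ≤ ‖T - S‖ * ‖x‖ := (T - S).le_opNorm x
    _ ≤ ‖T - S‖ * (|r| + 1) := by gcongr; linarith
    _ < ε := (lt_div_iff₀ (by positivity)).1 hT

end Pairing

/-! ### Weak*-closed ideals and their operators of rank one -/

section Ideals

variable {𝕜 E : Type*} [RCLike 𝕜] [NormedAddCommGroup E] [NormedSpace 𝕜 E]

theorem exists_eq_sum_smulRight_of_finiteDimensional_range (R : E →L[𝕜] E)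
    [FiniteDimensional 𝕜 (LinearMap.range (R : E →ₗ[𝕜] E))] :
    ∃ (n : ℕ) (y : Fin n → E) (l : Fin n → StrongDual 𝕜 E), R = ∑ i, (l i).smulRight (y i) := by
  let V := LinearMap.range (R : E →ₗ[𝕜] E)
  let b := Module.finBasis 𝕜 V
  let R' : E →L[𝕜] V := R.codRestrict V fun x => ⟨x, rfl⟩
  refine ⟨_, fun i => (b i : E), fun i => (LinearMap.toContinuousLinearMap (b.coord i)).comp R', ?_⟩
  ext x
  have h := congrArg (Subtype.val) (b.sum_repr (R' x))
  rw [Submodule.coe_sum] at h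
  have hx : R x = ((R' x : V) : E) := rfl
  rw [hx, ← h]
  simp [sum_apply]

theorem exists_strongDual_ne_zero_of_notMem {V : Type*} [NormedAddCommGroup V] [NormedSpace 𝕜 V]
    {M : Submodule 𝕜 V} (hM : IsClosed (M : Set V)) {x : V} (hx : x ∉ M) :
    ∃ g : StrongDual 𝕜 V, (∀ y ∈ M, g y = 0) ∧ g x ≠ 0 := by
  have := hM
  have hx' : M.mkQL x ≠ 0 := by simpa using hx
  obtain ⟨g, hg⟩ := SeparatingDual.exists_ne_zero (R := 𝕜) hx'
  exact ⟨g.comp M.mkQL, fun y hy => by simp [(Submodule.Quotient.mk_eq_zero M).2 hy], hg⟩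

theorem isClosed_weakStar_kerIdeal (D : Submodule 𝕜 E) :
    IsClosed[weakStarTopology 𝕜 E] (kerIdeal D : Set (E →L[𝕜] E)) := by
  have h : (kerIdeal D : Set (E →L[𝕜] E)) =
      ⋂ x ∈ D, ⋂ l : StrongDual 𝕜 E, {T | l (T x) = 0} := by
    ext T
    simp only [Set.mem_iInter, Set.mem_ofPred_eq]
    exact ⟨fun hT x hx l => by rw [show T x = 0 from hT hx, map_zero],
      fun hT x hx => (SeparatingDual.eq_zero_iff_forall_dual_eq_zero (R := 𝕜) (T x)).2 (hT x hx)⟩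
  rw [h]
  let _ : TopologicalSpace (E →L[𝕜] E) := weakStarTopology 𝕜 E
  exact isClosed_biInter fun x _ => isClosed_iInter fun l =>
    isClosed_eq (continuous_weakStar_apply x l) continuous_const

/-- By the Hahn–Banach theorem, `im T ⊆ F` says that `l (T x) = 0` for all `x` and all `l` that
vanish on `F`, and each of these conditions is weak*-closed. -/
theorem isClosed_weakStar_imIdeal (F : ClosedSubmodule 𝕜 E) :
    IsClosed[weakStarTopology 𝕜 E] (imIdeal F.toSubmodule : Set (E →L[𝕜] E)) := by
  have h : (imIdeal F.toSubmodule : Set (E →L[𝕜] E)) =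
      ⋂ x : E, ⋂ l : StrongDual 𝕜 E, ⋂ _ : ∀ y ∈ F.toSubmodule, l y = 0, {T | l (T x) = 0} := by
    ext T
    simp only [Set.mem_iInter, Set.mem_ofPred_eq]
    refine ⟨fun hT x l hl => hl _ (hT ⟨x, rfl⟩), fun hT => ?_⟩
    rintro _ ⟨x, rfl⟩
    by_contra hx
    obtain ⟨g, hg, hgx⟩ := exists_strongDual_ne_zero_of_notMem F.isClosed' hx
    exact hgx (hT x g hg)
  rw [h]
  let _ : TopologicalSpace (E →L[𝕜] E) := weakStarTopology 𝕜 E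
  exact isClosed_iInter fun x => isClosed_iInter fun l => isClosed_iInter fun _ =>
    isClosed_eq (continuous_weakStar_apply x l) continuous_const

/-- The functionals `l` for which a left ideal `J` contains all the operators `x ↦ l x • y`. -/
def rankOneFunctionals (J : Ideal (E →L[𝕜] E)) : Submodule 𝕜 (StrongDual 𝕜 E) where
  carrier := {l | ∀ y : E, l.smulRight y ∈ J}
  add_mem' {l m} hl hm y := by
    have h : (l + m).smulRight y = l.smulRight y + m.smulRight y := by ext x; simp [add_smul]
    rw [h]
    exact J.add_mem (hl y) (hm y)
  zero_mem' y := by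
    have h : (0 : StrongDual 𝕜 E).smulRight y = 0 := by ext x; simp
    rw [h]
    exact J.zero_mem
  smul_mem' a l hl y := by
    have h : (a • l).smulRight y = l.smulRight (a • y) := by
      ext x; simp [smul_smul, mul_comm]
    rw [h]
    exact hl _

/-- The vectors `y` for which a right ideal `J` contains all the operators `x ↦ l x • y`. -/
def rankOneVectors (J : Submodule (E →L[𝕜] E)ᵐᵒᵖ (E →L[𝕜] E)) : Submodule 𝕜 E where
  carrier := {y | ∀ l : StrongDual 𝕜 E, l.smulRight y ∈ J}
  add_mem' {y z} hy hz l := by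
    have h : l.smulRight (y + z) = l.smulRight y + l.smulRight z := by ext x; simp
    rw [h]
    exact J.add_mem (hy l) (hz l)
  zero_mem' l := by
    have h : l.smulRight (0 : E) = 0 := by ext x; simp
    rw [h]
    exact J.zero_mem
  smul_mem' a y hy l := by
    have h : l.smulRight (a • y) = (a • l).smulRight y := by
      ext x; simp [smul_smul, mul_comm]
    rw [h]
    exact hy _

theorem isClosed_rankOneFunctionals {J : Ideal (E →L[𝕜] E)}
    (hJ : IsClosed (J : Set (E →L[𝕜] E))) :
    IsClosed (rankOneFunctionals J : Set (StrongDual 𝕜 E)) := by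
  have h : (rankOneFunctionals J : Set (StrongDual 𝕜 E)) =
      ⋂ y : E, (fun l : StrongDual 𝕜 E => l.smulRight y) ⁻¹' (J : Set (E →L[𝕜] E)) := by
    ext l
    simp only [Set.mem_iInter]
    rfl
  rw [h]
  exact isClosed_iInter fun y =>
    hJ.preimage (((ContinuousLinearMap.smulRightL 𝕜 E E).flip y).continuous)

theorem isClosed_rankOneVectors {J : Submodule (E →L[𝕜] E)ᵐᵒᵖ (E →L[𝕜] E)}
    (hJ : IsClosed (J : Set (E →L[𝕜] E))) : IsClosed (rankOneVectors J : Set E) := by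
  have h : (rankOneVectors J : Set E) =
      ⋂ l : StrongDual 𝕜 E, (fun y : E => l.smulRight y) ⁻¹' (J : Set (E →L[𝕜] E)) := by
    ext l
    simp only [Set.mem_iInter]
    rfl
  rw [h]
  exact isClosed_iInter fun l =>
    hJ.preimage ((ContinuousLinearMap.smulRightL 𝕜 E E l).continuous)

/-- The closed subspace of the vectors that all functionals in `M` annihilate. -/
def preannihilator (M : Submodule 𝕜 (StrongDual 𝕜 E)) : ClosedSubmodule 𝕜 E where
  carrier := {x | ∀ l ∈ M, l x = 0}
  add_mem' hx hy l hl := by rw [map_add, hx l hl, hy l hl, add_zero]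
  zero_mem' l _ := map_zero l
  smul_mem' a x hx l hl := by rw [map_smul, hx l hl, smul_zero]
  isClosed' := by
    have h : {x : E | ∀ l ∈ M, l x = 0} = ⋂ l ∈ M, {x | l x = 0} := by ext; simp
    change IsClosed {x : E | ∀ l ∈ M, l x = 0}
    rw [h]
    exact isClosed_biInter fun l _ => isClosed_eq l.continuous continuous_const

/-- The bipolar theorem in the dual of a reflexive space, where norm-closed subspaces are
weak*-closed. -/
theorem mem_of_forall_mem_preannihilator (hrefl : IsReflexiveSpace 𝕜 E)
    {M : Submodule 𝕜 (StrongDual 𝕜 E)} (hM : IsClosed (M : Set (StrongDual 𝕜 E)))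
    {l : StrongDual 𝕜 E} (h : ∀ x ∈ (preannihilator M).toSubmodule, l x = 0) : l ∈ M := by
  by_contra hl
  obtain ⟨g, hg, hgl⟩ := exists_strongDual_ne_zero_of_notMem hM hl
  obtain ⟨x, rfl⟩ := hrefl g
  exact hgl (h x hg)

theorem eq_kerIdeal_of_isClosed_weakStar (hrefl : IsReflexiveSpace 𝕜 E)
    (hap : HasApproximationProperty 𝕜 E) {J : Ideal (E →L[𝕜] E)}
    (hJ : IsClosed[weakStarTopology 𝕜 E] (J : Set (E →L[𝕜] E))) :
    kerIdeal (preannihilator (rankOneFunctionals J)).toSubmodule = J := by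
  have hM := isClosed_rankOneFunctionals (isClosed_of_isClosed_weakStar hJ)
  apply le_antisymm
  · intro S hS
    refine mem_of_isClosed_weakStar hJ fun K hK ε hε => ?_
    -- `R` acts after `S`, as `J` is a left ideal, so it is to be close to the identity on the
    -- image of `K`.
    obtain ⟨R, hR, hRK⟩ := hap (S '' K) (hK.image S.continuous) ε hε
    refine ⟨R * S, ?_, fun x hx => hRK _ ⟨x, hx, rfl⟩⟩
    obtain ⟨n, y, l, rfl⟩ := exists_eq_sum_smulRight_of_finiteDimensional_range R
    rw [Finset.sum_mul]
    refine J.sum_mem fun i _ => ?_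
    have hmem : (l i).comp S ∈ rankOneFunctionals J :=
      mem_of_forall_mem_preannihilator hrefl hM fun x hx => by
        rw [ContinuousLinearMap.comp_apply, show S x = 0 from hS hx, map_zero]
    exact hmem (y i)
  · intro T hT x hx
    refine (SeparatingDual.eq_zero_iff_forall_dual_eq_zero (R := 𝕜) (T x)).2 fun l => ?_
    exact hx (l.comp T) fun y => J.mul_mem_left (l.smulRight y) hT

theorem eq_imIdeal_of_isClosed_weakStar (hap : HasApproximationProperty 𝕜 E)
    {J : Submodule (E →L[𝕜] E)ᵐᵒᵖ (E →L[𝕜] E)}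
    (hJ : IsClosed[weakStarTopology 𝕜 E] (J : Set (E →L[𝕜] E))) :
    imIdeal (rankOneVectors J) = J := by
  apply le_antisymm
  · intro S hS
    refine mem_of_isClosed_weakStar hJ fun K hK ε hε => ?_
    obtain ⟨R, hR, hRK⟩ := hap K hK (ε / (‖S‖ + 1)) (by positivity)
    refine ⟨S * R, ?_, fun x hx => ?_⟩
    · obtain ⟨n, y, l, rfl⟩ := exists_eq_sum_smulRight_of_finiteDimensional_range R
      rw [Finset.mul_sum]
      refine J.sum_mem fun i _ => ?_
      have h : S * (l i).smulRight (y i) = (l i).smulRight (S (y i)) := by ext x; simp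
      rw [h]
      exact hS ⟨y i, rfl⟩ (l i)
    · calc ‖(S * R) x - S x‖ = ‖S (R x - x)‖ := by rw [map_sub]; rfl
        _ ≤ ‖S‖ * ‖R x - x‖ := S.le_opNorm _
        _ ≤ (‖S‖ + 1) * ‖R x - x‖ := by gcongr; linarith
        _ < ε := (lt_div_iff₀' (by positivity)).1 (hRK x hx)
  · rintro T hT _ ⟨x, rfl⟩ l
    have h : l.smulRight (T x) = MulOpposite.op (l.smulRight x) • T := by ext z; simp
    exact h ▸ J.smul_mem _ hT

end Ideals

theorem theorem2p5 {𝕜 E : Type*} [RCLike 𝕜] [NormedAddCommGroup E] [NormedSpace 𝕜 E]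
    [CompleteSpace E] (hrefl : IsReflexiveSpace 𝕜 E) (hap : HasApproximationProperty 𝕜 E) :
    {J : Ideal (E →L[𝕜] E) | IsClosed[weakStarTopology 𝕜 E] (J : Set (E →L[𝕜] E))} =
        Set.range (fun F : ClosedSubmodule 𝕜 E => kerIdeal F.toSubmodule) ∧
      {J : Submodule (E →L[𝕜] E)ᵐᵒᵖ (E →L[𝕜] E) |
          IsClosed[weakStarTopology 𝕜 E] (J : Set (E →L[𝕜] E))} =
        Set.range (fun F : ClosedSubmodule 𝕜 E => imIdeal F.toSubmodule) := by
  refine ⟨Set.Subset.antisymm (fun J hJ => ?_) ?_, Set.Subset.antisymm (fun J hJ => ?_) ?_⟩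
  · exact ⟨preannihilator (rankOneFunctionals J), eq_kerIdeal_of_isClosed_weakStar hrefl hap hJ⟩
  · rintro _ ⟨F, rfl⟩
    exact isClosed_weakStar_kerIdeal F.toSubmodule
  · exact ⟨⟨rankOneVectors J, isClosed_rankOneVectors (isClosed_of_isClosed_weakStar hJ)⟩,
      eq_imIdeal_of_isClosed_weakStar hap hJ⟩
  · rintro _ ⟨F, rfl⟩
    exact isClosed_weakStar_imIdeal F
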